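/- Let $\mathbb F_q$ be a finite field with $q$ elements, $K=\mathbb F_q(\theta)$, and let $K_\infty$ be the completion of $K$ at the place $\infty$ (where $v_\infty(\theta)=-1$). Put $\ell_0=1$ and $\ell_d=\prod_{i=1}^d(\theta-\theta^{q^i})$ for $d\ge 1$. For $n\ge 0$, $\boldsymbol\varepsilon=(\varepsilon_1,\dots,\varepsilon_n)\in(\mathbb F_q^\times)^n$ and a tuple $\mathfrak s=(s_1,\dots,s_n)$ of positive integers, the alternating Carlitz multiple polylogarithm (ACMPL) is $$\mathrm{Li}\begin{pmatrix}\boldsymbol\varepsilon\\ \mathfrak s\end{pmatrix}=\sum_{d_1>\dots>d_n\ge 0}\frac{\varepsilon_1^{d_1}\cdots\varepsilon_n^{d_n}}{\ell_{d_1}^{s_1}\cdots\ell_{d_n}^{s_n}}\in K_\infty ,$$ equal to $1$ when $n=0$; its weight is $s_1+\dots+s_n$. For an integer $w\ge 0$, let $\mathcal{AL}_w$ be the $K$-vector subspace of $K_\infty$ spanned by all ACMPL's of weight $w$, and let $\mathcal{AT}_w$ be the set of the ACMPL's of weight $w$ such that $s_1,\dots,s_{n-1}\le q$ and $s_n<q$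 (no condition when $n=0$). Then $\mathcal{AT}_w$ generates the $K$-vector space $\mathcal{AL}_w$, that is, $\operatorname{span}_K\mathcal{AT}_w=\mathcal{AL}_w$. -/

import Mathlib

/-! Alternating Carlitz multiple polylogarithms (ACMPL's).

Throughout, `F` is a finite field with `q` elements, `K = F(θ)` is `RatFunc F` with
`θ = RatFunc.X`, and `K_∞` is `RatFunc.CompletionAtInfty F`, the completion of `K` at the place
`∞`, where `v(θ) = -1`. -/

noncomputable section

namespace ACMPL

/-! ### Two facts on `K_∞` -/

theorem nonarchimedean (F : Type*) [Field F] [DecidableEq (RatFunc F)] :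
    NonarchimedeanAddGroup (RatFunc.CompletionAtInfty F) where
  is_nonarchimedean U hU := by
    obtain ⟨γ, hγ⟩ := Valued.mem_nhds_zero.1 hU
    exact ⟨⟨Valuation.ltAddSubgroup Valued.v.restrict γ, Valued.isOpen_ball _ _⟩, hγ⟩

theorem val_coe {F : Type*} [Field F] [DecidableEq (RatFunc F)] (x : RatFunc F) :
    Valued.v (algebraMap (RatFunc F) (RatFunc.CompletionAtInfty F) x) =
      RatFunc.inftyValuation F x :=
  @Valued.valuedCompletion_apply (RatFunc F) _ (WithZero (Multiplicative ℤ)) _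
    (RatFunc.inftyValued F) x

/-! ### Definitions -/

variable (F : Type*) [Field F] [Fintype F]

/-- A positive array `(ε₁ … εₙ ; s₁ … sₙ)`, `n ≥ 0`, with `εᵢ ∈ F^×` and `sᵢ` positive integers,
as the list of its columns `(εᵢ, sᵢ)`. -/
abbrev PosArray : Type _ := List (Fˣ × ℕ+)

/-- `ℓ_d = ∏_{i=1}^d (θ - θ^{q^i})`; in particular `ℓ_0 = 1`. -/
def ell (d : ℕ) : RatFunc F :=
  ∏ i ∈ Finset.Icc 1 d, (RatFunc.X - RatFunc.X ^ Fintype.card F ^ i)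

variable {F}

/-- The depth one power sum `Si_d(ε; s) = ε^d / ℓ_d^s`, for a column `c = (ε, s)`. -/
def siOne (c : Fˣ × ℕ+) (d : ℕ) : RatFunc F :=
  RatFunc.C (c.1 : F) ^ d / ell F d ^ (c.2 : ℕ)

/-- `Si_{<d}(ε; s) = ∑_{d > d₁ > ⋯ > dₙ ≥ 0} ∏ᵢ εᵢ^{dᵢ} / ℓ_{dᵢ}^{sᵢ}`, as an iterated sum. It is
`1` for the empty array. -/
def siLt : PosArray F → ℕ → RatFunc F
  | [], _ => 1
  | c :: a, d => ∑ d₁ ∈ Finset.range d, siOne c d₁ * siLt a d₁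

/-- `Si_d(ε; s) = ∑_{d = d₁ > d₂ > ⋯ > dₙ ≥ 0} ∏ᵢ εᵢ^{dᵢ} / ℓ_{dᵢ}^{sᵢ}` for the nonempty array
with first column `c` and remaining columns `a`. -/
def si (c : Fˣ × ℕ+) (a : PosArray F) (d : ℕ) : RatFunc F :=
  siOne c d * siLt a d

/-- The ACMPL `Li(ε; s) = ∑_{d ≥ 0} Si_d(ε; s) ∈ K_∞`, with `Li = 1` for the empty array.
The series always converges, see `ACMPL.hasSum_Li`. -/
def Li [DecidableEq (RatFunc F)] : PosArray F → RatFunc.CompletionAtInfty F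
  | [] => 1
  | c :: a => ∑' d : ℕ, algebraMap (RatFunc F) (RatFunc.CompletionAtInfty F) (si c a d)

/-- The weight `s₁ + ⋯ + sₙ`. -/
def weight (a : PosArray F) : ℕ := (a.map fun c => (c.2 : ℕ)).sum

variable (F)

/-- The `K`-vector space `AL_w` spanned by the ACMPL's of weight `w`. -/
def AL [DecidableEq (RatFunc F)] (w : ℕ) :
    Submodule (RatFunc F) (RatFunc.CompletionAtInfty F) :=
  Submodule.span (RatFunc F) {x | ∃ a : PosArray F, weight a = w ∧ x = Li a}

/-- The set `AT_w` of the ACMPL's of weight `w` with `s₁, …, s_{n-1} ≤ q` and `sₙ < q`. -/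
def AT [DecidableEq (RatFunc F)] (w : ℕ) : Set (RatFunc.CompletionAtInfty F) :=
  {x | ∃ a : PosArray F, weight a = w ∧ (∀ c ∈ a.dropLast, (c.2 : ℕ) ≤ Fintype.card F) ∧
    (∀ c ∈ a.getLast?, (c.2 : ℕ) < Fintype.card F) ∧ x = Li a}

/-! ### Convergence -/

section Convergence

variable {F}
variable [DecidableEq (RatFunc F)]

open WithZero

theorem val_factor {i : ℕ} (hi : 1 ≤ i) :
    exp (1 : ℤ) ≤
      RatFunc.inftyValuation F (RatFunc.X - RatFunc.X ^ Fintype.card F ^ i) := by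
  have hq : 1 < Fintype.card F ^ i := Nat.one_lt_pow (by omega) Fintype.one_lt_card
  have h : RatFunc.inftyValuation F RatFunc.X <
      RatFunc.inftyValuation F (RatFunc.X ^ Fintype.card F ^ i) := by
    rw [map_pow, RatFunc.inftyValuation.X, ← exp_nsmul, exp_lt_exp]
    simpa using mod_cast hq
  rw [Valuation.map_sub_eq_of_lt_right _ h]
  rw [RatFunc.inftyValuation.X] at h
  exact h.le

theorem val_ell (d : ℕ) : exp (d : ℤ) ≤ RatFunc.inftyValuation F (ell F d) := by
  rw [ell, map_prod]
  calc exp (d : ℤ) = ∏ i ∈ Finset.Icc 1 d, exp (1 : ℤ) := by simp [← exp_nsmul]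
    _ ≤ _ := Finset.prod_le_prod' fun i hi => val_factor (Finset.mem_Icc.1 hi).1

theorem val_siOne (c : Fˣ × ℕ+) (d : ℕ) :
    RatFunc.inftyValuation F (siOne c d) ≤ exp (-(d : ℤ)) := by
  have hC := RatFunc.inftyValuation.C F c.1.ne_zero
  rw [siOne, map_div₀, map_pow, hC, one_pow, one_div, exp_neg, map_pow]
  have h1 : (1 : ℤᵐ⁰) ≤ RatFunc.inftyValuation F (ell F d) :=
    le_trans (by rw [← exp_zero, exp_le_exp]; positivity) (val_ell d)
  exact inv_anti₀ (by simp) ((val_ell d).trans (le_self_pow₀ h1 c.2.ne_zero))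

theorem val_siLt (a : PosArray F) (d : ℕ) : RatFunc.inftyValuation F (siLt a d) ≤ 1 := by
  induction a generalizing d with
  | nil => simp [siLt]
  | cons c a ih =>
    refine Valuation.map_sum_le _ fun d₁ _ => ?_
    rw [map_mul]
    refine mul_le_one' ((val_siOne c d₁).trans ?_) (ih d₁)
    rw [← exp_zero, exp_le_exp]
    simp

theorem val_si (c : Fˣ × ℕ+) (a : PosArray F) (d : ℕ) :
    RatFunc.inftyValuation F (si c a d) ≤ exp (-(d : ℤ)) := by
  rw [si, map_mul]
  exact mul_le_of_le_of_le_one (val_siOne c d) (val_siLt a d)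

/-- The series defining an ACMPL converges in `K_∞`. -/
theorem hasSum_Li (c : Fˣ × ℕ+) (a : PosArray F) :
    HasSum (fun d : ℕ => algebraMap (RatFunc F) (RatFunc.CompletionAtInfty F) (si c a d))
      (Li (c :: a)) := by
  have : CompleteSpace (RatFunc.CompletionAtInfty F) :=
    @UniformSpace.Completion.completeSpace (RatFunc F) (RatFunc.inftyValued F).toUniformSpace
  have := nonarchimedean F
  refine Summable.hasSum (NonarchimedeanAddGroup.summable_of_tendsto_cofinite_zero ?_)
  rw [Nat.cofinite_eq_atTop, (Valued.hasBasis_nhds_zero (RatFunc.CompletionAtInfty F)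
    ℤᵐ⁰).tendsto_right_iff]
  intro γ _
  have hγ : MonoidWithZeroHom.ValueGroup₀.embedding γ.1 ≠ 0 := by simp
  obtain ⟨n, hn⟩ : ∃ n : ℤ, MonoidWithZeroHom.ValueGroup₀.embedding γ.1 = exp n :=
    ⟨_, (exp_log hγ).symm⟩
  filter_upwards [Filter.eventually_gt_atTop n.natAbs] with d hd
  rw [Valuation.restrict_lt_iff_lt_embedding, hn, val_coe]
  refine (val_si c a d).trans_lt ?_
  rw [exp_lt_exp]
  omega

end Convergence

end ACMPL

end

/-!
Write `q` for the cardinality of `F`, and call arrays words. The sum `Si_{<d+1}(1; q - 1)`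
telescopes to `ℓ_{d+1} / (ℓ_1 ℓ_d^q)` (`siLt_predCard`), which gives the relation `siOne_card`,
`Si_d(ε; q) = ε⁻¹ ℓ_1 Si_{d+1}(ε, 1; 1, q - 1)`. Multiplying it by `Si_{<d+1}(v)` for
`v = (t, a)` and using the stuffle product yields, up to coefficients and signs, a relation
`(q + t, a)_d = (q, v)_d + (1, (q - 1) * v)_{d+1}`, where only exponents are written and `*` is the
stuffle product; for the one letter word `(q)` the same holds with `v` empty and without the term
`(q, v)` (`exists_si_eq`). Summed over all `d`, it rewrites an ACMPL whose first exponent is too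
large. Below a letter `s` the shift of `d` is absorbed by an additional term in which `s` is
increased: `(s, q + t, a)_d` is a combination of `(s, q, v)_d`, `(s, 1, b)_d` and `(s + 1, b)_d`
for the terms `b` of `(q - 1) * v` (`si_cons_mem_redSpan`). Further letters in front are harmless.
So every word which is not in `AT_w` can be rewritten.

The point is that rewriting terminates, although it may increase exponents. Define the height of
a word by `height [] = q + 1` and `height (s, a) = s + max(0, height a - q)`. Height never increases
under rewriting, since `height b ≤ q - 1 + height v` for the terms `b` of `(q - 1) * v`; it
decreases strictly if the first letter is rewritten; and if a term `(s + 1, b)` replaces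
`(s, q + t, a)`, then the first exponent increases, while it is bounded by the weight. Hence the
sequence of the pairs (height of the suffix, minus its first exponent), over all suffixes starting
with the longest, decreases lexicographically (`Reduces.of_height_lt`, `Reduces.merge`,
`Reduces.cons`). It is encoded as a natural number `rank`, and the theorem follows by induction on
it (`Li_mem_span_AT`).
-/

noncomputable section

namespace ACMPL

/-! ### Words and the stuffle product with a letter -/

variable {F : Type*} [Field F]

theorem weight_cons (c : Fˣ × ℕ+) (a : PosArray F) : weight (c :: a) = c.2 + weight a := by
  simp [weight]

theorem weight_nil : weight ([] : PosArray F) = 0 := rfl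

theorem length_le_weight (a : PosArray F) : a.length ≤ weight a := by
  induction a with
  | nil => simp
  | cons c a ih =>
    have := c.2.pos
    rw [weight_cons, List.length_cons]
    omega

/-- The product of two columns: signs are multiplied, exponents are added. -/
def colMul (x y : Fˣ × ℕ+) : Fˣ × ℕ+ := (x.1 * y.1, x.2 + y.2)

/-- The terms, with multiplicity, of the stuffle product of the one letter word `x` with a word. -/
def stuffle (x : Fˣ × ℕ+) : PosArray F → List (PosArray F)
  | [] => [[x]]
  | y :: v => (x :: y :: v) :: (colMul x y :: v) :: (stuffle x v).map (y :: ·)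

theorem weight_of_mem_stuffle {x : Fˣ × ℕ+} {v b : PosArray F} (hb : b ∈ stuffle x v) :
    weight b = x.2 + weight v := by
  induction v generalizing b with
  | nil => simp_all [stuffle, weight_cons, weight_nil]
  | cons y v ih =>
    simp only [stuffle, List.mem_cons, List.mem_map] at hb
    rcases hb with rfl | rfl | ⟨b, hb, rfl⟩
    · simp [weight_cons]
    · simp [weight_cons, colMul, add_assoc]
    · rw [weight_cons, ih hb, weight_cons]; omega

theorem ne_nil_of_mem_stuffle {x : Fˣ × ℕ+} {v b : PosArray F} (hb : b ∈ stuffle x v) :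
    b ≠ [] := by
  rintro rfl
  have := weight_of_mem_stuffle hb
  have := x.2.pos
  rw [weight_nil] at *
  omega

/-! ### The fundamental relation -/

variable [Fintype F]

variable (F) in
/-- The cardinality `q` of `F` as a positive integer. -/
def cardPNat : ℕ+ := ⟨Fintype.card F, Fintype.card_pos⟩

variable (F) in
/-- The positive integer `q - 1`. -/
def predCardPNat : ℕ+ := ⟨Fintype.card F - 1, Nat.sub_pos_of_lt Fintype.one_lt_card⟩

@[simp] theorem coe_cardPNat : (cardPNat F : ℕ) = Fintype.card F := rfl

@[simp] theorem coe_predCardPNat : (predCardPNat F : ℕ) = Fintype.card F - 1 := rfl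

theorem ell_zero : ell F 0 = 1 := by simp [ell]

theorem ell_succ (d : ℕ) :
    ell F (d + 1) = ell F d * (RatFunc.X - RatFunc.X ^ Fintype.card F ^ (d + 1)) :=
  Finset.prod_Icc_succ_top (by omega) _

theorem ell_ne_zero (d : ℕ) : ell F d ≠ 0 := by
  classical
  intro h
  have := val_ell (F := F) d
  simp [h] at this

theorem ell_succ_pow_card (d : ℕ) :
    ell F (d + 1) ^ Fintype.card F = ell F d ^ Fintype.card F *
      (RatFunc.X ^ Fintype.card F - RatFunc.X ^ Fintype.card F ^ (d + 2)) := by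
  have h := map_sub (FiniteField.frobeniusAlgHom F (RatFunc F)) RatFunc.X
    (RatFunc.X ^ Fintype.card F ^ (d + 1))
  simp only [FiniteField.coe_frobeniusAlgHom] at h
  rw [ell_succ, mul_pow, h, ← pow_mul, ← pow_succ]

/-- The closed form of `Si_{<d+1}(1; q - 1)`, obtained by telescoping. -/
theorem siLt_predCard (d : ℕ) :
    siLt [((1 : Fˣ), predCardPNat F)] (d + 1) =
      ell F (d + 1) / (ell F 1 * ell F d ^ Fintype.card F) := by
  have hq : Fintype.card F = (Fintype.card F - 1) + 1 :=
    (Nat.sub_add_cancel Fintype.card_pos).symm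
  have h1 := ell_ne_zero (F := F) 1
  induction d with
  | zero => simp [siLt, siOne, ell_zero, h1]
  | succ d ih =>
    have h0 := ell_ne_zero (F := F) (d + 1)
    have h2 : ell F (d + 1) ^ Fintype.card F ≠ 0 := pow_ne_zero _ h0
    have h3 := ell_succ_pow_card (F := F) d
    have h4 : ell F d ^ Fintype.card F ≠ 0 := pow_ne_zero _ (ell_ne_zero d)
    have h5 : ell F (d + 1) ^ Fintype.card F =
        ell F (d + 1) ^ (Fintype.card F - 1) * ell F (d + 1) := by
      rw [← pow_succ, ← hq]
    have h6 := ell_succ (F := F) (d + 1)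
    have h7 : ell F 1 = RatFunc.X - RatFunc.X ^ Fintype.card F := by
      simp [ell]
    have h8 : ell F (d + 1) ^ (Fintype.card F - 1) ≠ 0 := pow_ne_zero _ h0
    have h9 : siLt [((1 : Fˣ), predCardPNat F)] (d + 1 + 1) =
        siLt [((1 : Fˣ), predCardPNat F)] (d + 1) +
          1 / ell F (d + 1) ^ (Fintype.card F - 1) := by
      simp [siLt, Finset.sum_range_succ _ (d + 1), siOne]
    have h10 : 1 / ell F (d + 1) ^ (Fintype.card F - 1) =
        ell F (d + 1) / ell F (d + 1) ^ Fintype.card F := by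
      rw [h5]; field_simp
    rw [h9, ih, h10, div_add_div _ _ (mul_ne_zero h1 h4) h2,
      div_eq_div_iff (mul_ne_zero (mul_ne_zero h1 h4) h2) (mul_ne_zero h1 h2), h6]
    -- `(θ - θ^{q^{d+2}}) = (θ^q - θ^{q^{d+2}}) + (θ - θ^q)`, which makes the sum telescope.
    have h11 : ell F d ^ Fintype.card F * (RatFunc.X - RatFunc.X ^ Fintype.card F ^ (d + 1 + 1)) =
        ell F (d + 1) ^ Fintype.card F + ell F 1 * ell F d ^ Fintype.card F := by
      rw [h3, h7]; ring
    linear_combination (-ell F (d + 1) * ell F 1 * ell F (d + 1) ^ Fintype.card F) * h11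

/-- The relation from which all others are derived: it trades the exponent `q` at `d` for the
exponents `1, q - 1` at `d + 1`. -/
theorem siOne_card (ε : Fˣ) (d : ℕ) :
    siOne (ε, cardPNat F) d = RatFunc.C (ε : F)⁻¹ * ell F 1 *
      (siOne (ε, 1) (d + 1) * siLt [((1 : Fˣ), predCardPNat F)] (d + 1)) := by
  have h1 := ell_ne_zero (F := F) 1
  have h2 := ell_ne_zero (F := F) (d + 1)
  have h3 := ell_ne_zero (F := F) d
  have hC : RatFunc.C (ε : F) ≠ 0 := by simp
  rw [siLt_predCard]
  simp only [siOne, coe_cardPNat, PNat.one_coe, pow_one, map_inv₀]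
  field_simp
  ring

/-! ### The stuffle product of power sums -/

theorem siOne_colMul (x y : Fˣ × ℕ+) (d : ℕ) :
    siOne (colMul x y) d = siOne x d * siOne y d := by
  simp only [siOne, colMul, Units.val_mul, map_mul, PNat.add_coe, mul_pow, pow_add]
  rw [mul_div_mul_comm]

theorem siLt_cons_succ (c : Fˣ × ℕ+) (a : PosArray F) (d : ℕ) :
    siLt (c :: a) (d + 1) = siLt (c :: a) d + si c a d := by
  simp [siLt, si, Finset.sum_range_succ]

theorem siLt_cons_zero (c : Fˣ × ℕ+) (a : PosArray F) : siLt (c :: a) 0 = 0 := by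
  simp [siLt]

theorem siLt_cons_eq_sum (c : Fˣ × ℕ+) (a : PosArray F) (d : ℕ) :
    siLt (c :: a) d = ∑ i ∈ Finset.range d, si c a i := rfl

/-- For each column `siOne` is multiplicative, so that products of power sums follow the simple
stuffle rule, with no correction terms. -/
theorem sum_siLt_stuffle (x : Fˣ × ℕ+) (v : PosArray F) (d : ℕ) :
    ((stuffle x v).map (siLt · d)).sum = siLt [x] d * siLt v d := by
  induction v generalizing d with
  | nil => simp [stuffle, siLt]
  | cons y v ih =>
    have key : ∀ (l : List (PosArray F)) (d : ℕ),
        (l.map fun b => siLt (y :: b) (d + 1)).sum =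
          (l.map fun b => siLt (y :: b) d).sum + siOne y d * (l.map (siLt · d)).sum := by
      intro l d
      simp only [siLt_cons_succ, si, List.sum_map_add, List.sum_map_mul_left]
    induction d with
    | zero =>
      simp only [stuffle, List.map_cons, List.map_map, List.sum_cons, siLt_cons_zero, zero_mul,
        zero_add, Function.comp_def]
      simp
    | succ d ihd =>
      simp only [stuffle, List.map_cons, List.map_map, List.sum_cons, Function.comp_def] at ihd ⊢
      rw [key, ih]
      simp only [siLt_cons_succ, si, siOne_colMul] at ihd ⊢
      have h1 : siLt [] d = (1 : RatFunc F) := rfl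
      rw [h1]
      linear_combination ihd

/-! ### The measure of a word -/

/-- The height `max_j (s₁ + ⋯ + s_j - (j - 1) q)` of a word, where the last exponent is counted
with an additional `1`; the value at the empty word makes the recursion uniform. -/
def height : PosArray F → ℕ
  | [] => Fintype.card F + 1
  | c :: a => c.2 + (height a - Fintype.card F)

theorem height_le (a : PosArray F) : height a ≤ weight a + Fintype.card F + 1 := by
  induction a with
  | nil => simp [height]
  | cons c a ih => rw [height, weight_cons]; omega

/-- This subadditivity is why the terms which a stuffle product contributes to a relation are not
higher than the word being reduced. -/
theorem height_of_mem_stuffle {x : Fˣ × ℕ+} {v b : PosArray F} (hb : b ∈ stuffle x v) :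
    height b ≤ x.2 + height v := by
  induction v generalizing b with
  | nil => simp_all [stuffle, height]
  | cons y v ih =>
    simp only [stuffle, List.mem_cons, List.mem_map] at hb
    rcases hb with rfl | rfl | ⟨b, hb, rfl⟩
    · simp [height]
    · simp [height, colMul, add_assoc]
    · have := ih hb
      simp only [height]
      omega

/-- The base in which `rank` is written; it exceeds all digits for words of weight `≤ W`. -/
def rankBase (F : Type*) [Fintype F] (W : ℕ) : ℕ := (W + Fintype.card F + 2) * (W + 1)

/-- The leading digit of the rank: it orders words by their height, and words of the same height
by decreasing first exponent. -/
def digit (W : ℕ) (c : Fˣ × ℕ+) (a : PosArray F) : ℕ := height (c :: a) * (W + 1) + (W - c.2)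

/-- A natural number encoding, for words of length `≤ n` and weight `≤ W`, the lexicographic order
on the sequences of digits of all nonempty suffixes, the longest suffix being the most
significant. -/
def rank (W : ℕ) : ℕ → PosArray F → ℕ
  | 0, _ => 0
  | _ + 1, [] => 0
  | n + 1, c :: a => digit W c a * rankBase F W ^ n + rank W n a

theorem digit_lt {W : ℕ} {c : Fˣ × ℕ+} {a : PosArray F} (h : weight (c :: a) ≤ W) :
    digit W c a < rankBase F W := by
  have h1 := height_le (c :: a)
  have h2 : height (c :: a) * (W + 1) ≤ (W + Fintype.card F + 1) * (W + 1) :=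
    Nat.mul_le_mul_right _ (by omega)
  have h3 : (W + Fintype.card F + 2) * (W + 1) =
      (W + Fintype.card F + 1) * (W + 1) + (W + 1) := by ring
  rw [digit, rankBase]
  omega

theorem rank_lt {W : ℕ} (n : ℕ) {a : PosArray F} (h : weight a ≤ W) :
    rank W n a < rankBase F W ^ n := by
  have hB : 0 < rankBase F W := by unfold rankBase; positivity
  induction n generalizing a with
  | zero => simp [rank]
  | succ n ih =>
    cases a with
    | nil => simp only [rank]; positivity
    | cons c a =>
      have h1 := digit_lt h
      rw [weight_cons] at h
      have h2 := ih (a := a) (by omega)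
      calc rank W (n + 1) (c :: a) < digit W c a * rankBase F W ^ n + rankBase F W ^ n := by
            simpa [rank] using h2
        _ = (digit W c a + 1) * rankBase F W ^ n := by ring
        _ ≤ rankBase F W * rankBase F W ^ n := Nat.mul_le_mul_right _ h1
        _ = _ := by ring

theorem rank_lt_of_digit_lt {W n : ℕ} {c c' : Fˣ × ℕ+} {a b : PosArray F}
    (hb : weight (c' :: b) ≤ W) (h : digit W c' b < digit W c a) :
    rank W (n + 1) (c' :: b) < rank W (n + 1) (c :: a) := by
  rw [weight_cons] at hb
  have h2 := rank_lt n (a := b) (W := W) (by omega)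
  calc rank W (n + 1) (c' :: b) < digit W c' b * rankBase F W ^ n + rankBase F W ^ n := by
        simpa [rank] using h2
    _ = (digit W c' b + 1) * rankBase F W ^ n := by ring
    _ ≤ digit W c a * rankBase F W ^ n := Nat.mul_le_mul_right _ h
    _ ≤ _ := Nat.le_add_right _ _

theorem digit_lt_of_height_lt {W : ℕ} {c c' : Fˣ × ℕ+} {a b : PosArray F}
    (h : height (c' :: b) < height (c :: a)) : digit W c' b < digit W c a := by
  have : (height (c' :: b) + 1) * (W + 1) ≤ height (c :: a) * (W + 1) :=
    Nat.mul_le_mul_right _ h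
  simp only [digit]
  rw [add_mul, one_mul] at this
  omega

/-- The order in which words are reduced: `Reduces W n b a` says that `b` has the same weight as
`a`, is not higher, and has smaller rank. -/
structure Reduces (W n : ℕ) (b a : PosArray F) : Prop where
  weight_eq : weight b = weight a
  height_le : height b ≤ height a
  rank_lt : rank W n b < rank W n a

theorem Reduces.of_height_lt {W n : ℕ} {c c' : Fˣ × ℕ+} {a b : PosArray F}
    (hW : weight (c :: a) ≤ W) (hw : weight (c' :: b) = weight (c :: a))
    (h : height (c' :: b) < height (c :: a)) : Reduces W (n + 1) (c' :: b) (c :: a) :=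
  ⟨hw, h.le, rank_lt_of_digit_lt (hw.trans_le hW) (digit_lt_of_height_lt h)⟩

theorem Reduces.cons {W n : ℕ} {a b : PosArray F} (h : Reduces W n b a) (c : Fˣ × ℕ+) :
    Reduces W (n + 1) (c :: b) (c :: a) := by
  have hh : height (c :: b) ≤ height (c :: a) := by
    have := h.height_le
    simp only [height]
    omega
  refine ⟨by simp [weight_cons, h.weight_eq], hh, ?_⟩
  have : digit W c b ≤ digit W c a := Nat.add_le_add_right (Nat.mul_le_mul_right _ hh) _
  exact add_lt_add_of_le_of_lt (Nat.mul_le_mul_right _ this) h.rank_lt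

/-- Raising the first exponent by `1` at the cost of the rest of the word. -/
theorem Reduces.merge {W n : ℕ} {c x : Fˣ × ℕ+} {a b : PosArray F}
    (hW : weight (c :: a) ≤ W) (hx : (x.2 : ℕ) = 1) (hw : weight b + 1 = weight a)
    (hb : height b < height a) (ha : Fintype.card F < height a) :
    Reduces W (n + 1) (colMul c x :: b) (c :: a) := by
  have hw' : weight (colMul c x :: b) = weight (c :: a) := by
    simp only [weight_cons, colMul, PNat.add_coe, hx]; omega
  have hh : height (colMul c x :: b) ≤ height (c :: a) := by
    simp only [height, colMul, PNat.add_coe, hx]; omega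
  refine ⟨hw', hh, rank_lt_of_digit_lt (hw'.trans_le hW) ?_⟩
  have h1 : height (colMul c x :: b) * (W + 1) ≤ height (c :: a) * (W + 1) :=
    Nat.mul_le_mul_right _ hh
  rw [weight_cons] at hW
  simp only [digit, colMul, PNat.add_coe, hx] at h1 ⊢
  omega

/-! ### Reduction of words -/

/-- The first exponent of the word `c :: a` violates the condition defining `AT_w`: it exceeds `q`,
or it is also the last one and equals `q`. -/
def HeadLarge (c : Fˣ × ℕ+) (a : PosArray F) : Prop :=
  Fintype.card F < c.2 ∨ (a = [] ∧ (c.2 : ℕ) = Fintype.card F)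

/-- No exponent of the word violates the condition defining `AT_w`. -/
def IsReduced : PosArray F → Prop
  | [] => True
  | c :: a => ¬ HeadLarge c a ∧ IsReduced a

theorem isReduced_iff (a : PosArray F) : IsReduced a ↔
    (∀ c ∈ a.dropLast, (c.2 : ℕ) ≤ Fintype.card F) ∧
      (∀ c ∈ a.getLast?, (c.2 : ℕ) < Fintype.card F) := by
  induction a with
  | nil => simp [IsReduced]
  | cons c a ih =>
    cases a with
    | nil =>
      simp only [IsReduced, HeadLarge, List.dropLast_singleton, List.getLast?_singleton,
        List.not_mem_nil, Option.mem_some_iff, forall_eq', true_and, and_true,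
        IsEmpty.forall_iff, implies_true]
      omega
    | cons c' a =>
      rw [IsReduced, ih]
      simp [HeadLarge, List.getLast?_cons_cons, and_assoc]

theorem card_lt_height {c : Fˣ × ℕ+} {a : PosArray F} (h : HeadLarge c a) :
    Fintype.card F < height (c :: a) := by
  rcases h with h | ⟨rfl, h⟩ <;> simp only [height] <;> omega

/-- A word with too large a first exponent is, at `d`, a combination of lower words at `d` and of
words at `d + 1` with first exponent `1`. -/
theorem exists_si_eq {c : Fˣ × ℕ+} {a : PosArray F} (h : HeadLarge c a) :
    ∃ (β : RatFunc F) (A : List ((Fˣ × ℕ+) × PosArray F)) (B : List (PosArray F)),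
      (∀ d, si c a d = -(A.map fun g => si g.1 g.2 d).sum +
        β * (B.map fun b => si (c.1, 1) b (d + 1)).sum) ∧
      (∀ g ∈ A, weight (g.1 :: g.2) = weight (c :: a) ∧
        height (g.1 :: g.2) < height (c :: a)) ∧
      ∀ b ∈ B, b ≠ [] ∧ weight b + 1 = weight (c :: a) ∧ height b < height (c :: a) := by
  have hq : 0 < Fintype.card F := Fintype.card_pos
  have hsum : ∀ (v : PosArray F) (d : ℕ),
      RatFunc.C (c.1 : F)⁻¹ * ell F 1 *
        ((stuffle ((1 : Fˣ), predCardPNat F) v).map fun b => si (c.1, 1) b (d + 1)).sum =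
      siOne (c.1, cardPNat F) d * siLt v (d + 1) := by
    intro v d
    simp only [si, List.sum_map_mul_left, sum_siLt_stuffle, siOne_card]
    ring
  refine ⟨RatFunc.C (c.1 : F)⁻¹ * ell F 1, ?_⟩
  rcases h with h | ⟨rfl, h⟩
  -- Write `c = (c.1, q) · (1, t)` and multiply the relation `siOne_card` by `Si_{<d+1}` of the word
  -- `(1, t) :: a`.
  · let t : ℕ+ := ⟨c.2 - Fintype.card F, Nat.sub_pos_of_lt h⟩
    have ht : (t : ℕ) = c.2 - Fintype.card F := rfl
    have hc : colMul (c.1, cardPNat F) ((1 : Fˣ), t) = c := by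
      refine Prod.ext (mul_one _) (PNat.coe_injective ?_)
      simp only [colMul, PNat.add_coe, coe_cardPNat, ht]
      omega
    refine ⟨[((c.1, cardPNat F), ((1 : Fˣ), t) :: a)],
      stuffle ((1 : Fˣ), predCardPNat F) (((1 : Fˣ), t) :: a), ?_, ?_, ?_⟩
    · intro d
      have h1 : si c a d = siOne (c.1, cardPNat F) d * si ((1 : Fˣ), t) a d := by
        conv_lhs => rw [← hc]
        rw [si, siOne_colMul, si]
        ring
      rw [hsum, siLt_cons_succ, h1]
      simp only [List.map_cons, List.map_nil, List.sum_cons, List.sum_nil]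
      have h2 : si (c.1, cardPNat F) (((1 : Fˣ), t) :: a) d =
          siOne (c.1, cardPNat F) d * siLt (((1 : Fˣ), t) :: a) d := rfl
      rw [h2]
      ring
    · simp only [List.mem_singleton, forall_eq, weight_cons, height, coe_cardPNat, ht]
      omega
    · intro b hb
      have h1 := weight_of_mem_stuffle hb
      have h2 := height_of_mem_stuffle hb
      refine ⟨ne_nil_of_mem_stuffle hb, ?_⟩
      simp only [weight_cons, height, coe_predCardPNat, ht] at h1 h2 ⊢
      omega
  -- For the word `[c]` with exponent `q` this is the relation `siOne_card` itself.
  · refine ⟨[], stuffle ((1 : Fˣ), predCardPNat F) [], ?_, by simp, ?_⟩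
    · intro d
      have hc : (c.1, cardPNat F) = c := Prod.ext rfl (PNat.coe_injective h.symm)
      rw [hsum, hc]
      simp [si, siLt]
    · simp only [stuffle, List.mem_singleton, forall_eq, weight_cons, weight_nil, height,
        coe_predCardPNat]
      refine ⟨by simp, ?_⟩
      omega

/-- The space of the sequences `d ↦ Si_d(b)`, for the nonempty words `b` to which `a` may be
reduced. -/
def redSpan (W n : ℕ) (a : PosArray F) : Submodule (RatFunc F) (ℕ → RatFunc F) :=
  Submodule.span (RatFunc F) {f | ∃ c b, Reduces W n (c :: b) a ∧ f = si c b}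

theorem si_mem_redSpan {W n : ℕ} {a b : PosArray F} {c : Fˣ × ℕ+} (h : Reduces W n (c :: b) a) :
    si c b ∈ redSpan W n a :=
  Submodule.subset_span ⟨c, b, h, rfl⟩

theorem list_sum_map_mem {R M ι : Type*} [Semiring R] [AddCommMonoid M] [Module R M]
    (p : Submodule R M) (l : List ι) (f : ι → M) (h : ∀ i ∈ l, f i ∈ p) :
    (l.map f).sum ∈ p :=
  list_sum_mem (by simpa using h)

theorem list_sum_map_apply {M ι : Type*} [AddCommMonoid M] (l : List ι) (f : ι → ℕ → M) (d : ℕ) :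
    (l.map f).sum d = (l.map (f · d)).sum := by
  induction l with
  | nil => rfl
  | cons i l ih => simp [ih]

/-- Prepending a letter to a word, as an operator on sequences. -/
def prepend (c : Fˣ × ℕ+) : (ℕ → RatFunc F) →ₗ[RatFunc F] (ℕ → RatFunc F) where
  toFun f d := siOne c d * ∑ i ∈ Finset.range d, f i
  map_add' f g := by
    ext d
    simp [Finset.sum_add_distrib, mul_add]
  map_smul' r f := by
    ext d
    simp only [Pi.smul_apply, smul_eq_mul, ← Finset.mul_sum, RingHom.id_apply]
    ring

theorem prepend_apply (c : Fˣ × ℕ+) (f : ℕ → RatFunc F) (d : ℕ) :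
    prepend c f d = siOne c d * ∑ i ∈ Finset.range d, f i := rfl

theorem prepend_si (c x : Fˣ × ℕ+) (a : PosArray F) : prepend c (si x a) = si c (x :: a) := rfl

/-- Prepending a letter to a shifted power sum shifts the upper bound of the inner sum; the new
boundary term merges the two first letters. -/
theorem prepend_shift_si (c x : Fˣ × ℕ+) {b : PosArray F} (hb : b ≠ []) :
    prepend c (fun d => si x b (d + 1)) = si c (x :: b) + si (colMul c x) b := by
  obtain ⟨y, b, rfl⟩ := List.exists_cons_of_ne_nil hb
  ext d
  have h := Finset.sum_range_succ' (si x (y :: b)) d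
  rw [show si x (y :: b) 0 = 0 by rw [si, siLt_cons_zero, mul_zero], add_zero,
    ← siLt_cons_eq_sum, siLt_cons_succ] at h
  rw [prepend_apply, ← h, Pi.add_apply, si, si, si, siOne_colMul]
  ring

/-- The relation of `exists_si_eq` below a letter `c`. There all terms are again taken at `d`: a
shifted word `(ε, 1) :: b` contributes `c :: (ε, 1) :: b` and the merged word, whose first exponent
is larger by `1`. -/
theorem si_cons_mem_redSpan {W n : ℕ} {c x : Fˣ × ℕ+} {a : PosArray F} (h : HeadLarge x a)
    (hW : weight (c :: x :: a) ≤ W) :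
    si c (x :: a) ∈ redSpan W (n + 2) (c :: x :: a) := by
  obtain ⟨β, A, B, hs, hA, hB⟩ := exists_si_eq h
  have hq := card_lt_height h
  have hW' : weight (x :: a) ≤ W := by rw [weight_cons] at hW; omega
  have hs' : si x a = -(A.map fun g => si g.1 g.2).sum +
      β • (B.map fun b d => si (x.1, 1) b (d + 1)).sum := by
    ext d
    simp only [hs d, Pi.add_apply, Pi.neg_apply, Pi.smul_apply, smul_eq_mul, list_sum_map_apply]
  rw [← prepend_si, hs', map_add, map_neg, map_smul, map_list_sum, map_list_sum, List.map_map,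
    List.map_map]
  refine Submodule.add_mem _ (Submodule.neg_mem _ (list_sum_map_mem _ _ _ fun g hg => ?_))
    (Submodule.smul_mem _ _ (list_sum_map_mem _ _ _ fun b hb => ?_))
  · exact si_mem_redSpan ((Reduces.of_height_lt hW' (hA g hg).1 (hA g hg).2).cons c)
  · obtain ⟨h0, h1, h2⟩ := hB b hb
    rw [Function.comp_apply, prepend_shift_si c _ h0]
    refine Submodule.add_mem _ (si_mem_redSpan (Reduces.cons (Reduces.of_height_lt hW' ?_ ?_) c))
      (si_mem_redSpan (Reduces.merge hW rfl h1 h2 hq))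
    · rw [← h1, weight_cons, PNat.one_coe, add_comm]
    · rw [height, PNat.one_coe]
      have : 1 < Fintype.card F := Fintype.one_lt_card
      omega

/-- An exponent violating the condition at any place but the first one can be reduced already on
the level of the power sums `Si_d`. -/
theorem si_mem_redSpan_of_not_isReduced {W n : ℕ} {c : Fˣ × ℕ+} {a : PosArray F}
    (h : ¬ IsReduced a) (hn : a.length ≤ n) (hW : weight (c :: a) ≤ W) :
    si c a ∈ redSpan W (n + 1) (c :: a) := by
  induction a generalizing c n with
  | nil => exact absurd trivial h
  | cons x a ih =>
    obtain ⟨n, rfl⟩ : ∃ m, n = m + 1 := ⟨n - 1, by simp at hn; omega⟩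
    by_cases hx : HeadLarge x a
    · exact si_cons_mem_redSpan hx hW
    · have ha : si x a ∈ redSpan W (n + 1) (x :: a) := by
        refine ih (fun ha => h ⟨hx, ha⟩) (by simpa using hn) ?_
        rw [weight_cons] at hW
        omega
      have hle : redSpan W (n + 1) (x :: a) ≤
          (redSpan W (n + 2) (c :: x :: a)).comap (prepend c) := by
        refine Submodule.span_le.2 ?_
        rintro _ ⟨y, b, hb, rfl⟩
        exact si_mem_redSpan (hb.cons c)
      exact hle ha

/-! ### Reduction of polylogarithms -/

variable [DecidableEq (RatFunc F)]

local notation "K∞" => RatFunc.CompletionAtInfty F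

/-- The series of the shifted sequence has the same sum, as `Si_0` vanishes in depth `≥ 2`. -/
theorem hasSum_shift_si (c : Fˣ × ℕ+) {b : PosArray F} (hb : b ≠ []) :
    HasSum (fun d => algebraMap (RatFunc F) K∞ (si c b (d + 1))) (Li (c :: b)) := by
  obtain ⟨y, b, rfl⟩ := List.exists_cons_of_ne_nil hb
  have h0 : si c (y :: b) 0 = 0 := by rw [si, siLt_cons_zero, mul_zero]
  have := (hasSum_nat_add_iff' 1).2 (hasSum_Li c (y :: b))
  simpa [h0] using this

omit [Fintype F] in
theorem hasSum_list_sum {ι : Type*} (l : List ι) (f : ι → ℕ → RatFunc F) (x : ι → K∞)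
    (h : ∀ i ∈ l, HasSum (fun d => algebraMap (RatFunc F) K∞ (f i d)) (x i)) :
    HasSum (fun d => algebraMap (RatFunc F) K∞ (l.map (f · d)).sum) (l.map x).sum := by
  induction l with
  | nil => simp [hasSum_zero]
  | cons i l ih =>
    simp only [List.map_cons, List.sum_cons, map_add]
    exact (h i (by simp)).add (ih fun j hj => h j (by simp [hj]))

/-- Summation over `d` carries relations between power sums to relations between ACMPL's. -/
theorem exists_hasSum_of_mem_redSpan {W n : ℕ} {a : PosArray F} {f : ℕ → RatFunc F}
    (hf : f ∈ redSpan W n a) :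
    ∃ x ∈ Submodule.span (RatFunc F) {x : K∞ | ∃ b, Reduces W n b a ∧ x = Li b},
      HasSum (fun d => algebraMap (RatFunc F) K∞ (f d)) x := by
  induction hf using Submodule.span_induction with
  | mem f hf =>
    obtain ⟨c, b, h, rfl⟩ := hf
    exact ⟨_, Submodule.subset_span ⟨_, h, rfl⟩, hasSum_Li c b⟩
  | zero => exact ⟨0, Submodule.zero_mem _, by simp [hasSum_zero]⟩
  | add f g _ _ hf hg =>
    obtain ⟨x, hx, hfx⟩ := hf
    obtain ⟨y, hy, hgy⟩ := hg
    exact ⟨x + y, Submodule.add_mem _ hx hy, by simpa using hfx.add hgy⟩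
  | smul r f _ hf =>
    obtain ⟨x, hx, hfx⟩ := hf
    refine ⟨r • x, Submodule.smul_mem _ _ hx, ?_⟩
    simpa [Algebra.smul_def] using hfx.mul_left (algebraMap (RatFunc F) K∞ r)

theorem Li_mem_span_of_headLarge {W n : ℕ} {c : Fˣ × ℕ+} {a : PosArray F} (h : HeadLarge c a)
    (hW : weight (c :: a) ≤ W) :
    Li (c :: a) ∈
      Submodule.span (RatFunc F) {x : K∞ | ∃ b, Reduces W (n + 1) b (c :: a) ∧ x = Li b} := by
  obtain ⟨β, A, B, hs, hA, hB⟩ := exists_si_eq h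
  have hq := card_lt_height h
  have h1 := hasSum_list_sum A (fun g => si g.1 g.2) (fun g => Li (g.1 :: g.2))
    fun g _ => hasSum_Li g.1 g.2
  have h2 := hasSum_list_sum B (fun b d => si (c.1, 1) b (d + 1)) (fun b => Li ((c.1, 1) :: b))
    fun b hb => hasSum_shift_si _ (hB b hb).1
  have h3 := h1.neg.add (h2.mul_left (algebraMap (RatFunc F) K∞ β))
  simp only [← map_neg, ← map_mul, ← map_add, ← hs] at h3
  rw [(hasSum_Li c a).unique h3, ← Algebra.smul_def]
  refine Submodule.add_mem _ (Submodule.neg_mem _ (list_sum_map_mem _ _ _ fun g hg => ?_))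
    (Submodule.smul_mem _ _ (list_sum_map_mem _ _ _ fun b hb => ?_))
  · exact Submodule.subset_span ⟨_, Reduces.of_height_lt hW (hA g hg).1 (hA g hg).2, rfl⟩
  · obtain ⟨-, h1, h2⟩ := hB b hb
    refine Submodule.subset_span ⟨_, Reduces.of_height_lt hW ?_ ?_, rfl⟩
    · rw [← h1, weight_cons, PNat.one_coe, add_comm]
    · rw [height.eq_2, PNat.one_coe]
      have : 1 < Fintype.card F := Fintype.one_lt_card
      omega

theorem Li_mem_span_of_not_isReduced {W n : ℕ} {a : PosArray F} (h : ¬ IsReduced a)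
    (hn : a.length ≤ n) (hW : weight a ≤ W) :
    Li a ∈ Submodule.span (RatFunc F) {x : K∞ | ∃ b, Reduces W n b a ∧ x = Li b} := by
  cases a with
  | nil => exact absurd trivial h
  | cons c a =>
    obtain ⟨n, rfl⟩ : ∃ m, n = m + 1 := ⟨n - 1, by simp at hn; omega⟩
    by_cases hc : HeadLarge c a
    · exact Li_mem_span_of_headLarge hc hW
    · obtain ⟨x, hx, hsum⟩ := exists_hasSum_of_mem_redSpan
        (si_mem_redSpan_of_not_isReduced (fun ha => h ⟨hc, ha⟩) (by simpa using hn) hW)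
      rwa [(hasSum_Li c a).unique hsum]

/-- Reduction terminates at the words of `AT_w`. The length of a word of weight `w` is at most `w`,
so that rank with `w` digits takes all of its letters into account. -/
theorem Li_mem_span_AT (a : PosArray F) :
    Li a ∈ Submodule.span (RatFunc F) (AT F (weight a)) := by
  generalize hw : weight a = w
  induction hr : rank w w a using Nat.strong_induction_on generalizing a with
  | _ r ih =>
    by_cases h : IsReduced a
    · obtain ⟨h1, h2⟩ := (isReduced_iff a).1 h
      exact Submodule.subset_span ⟨a, hw, h1, h2, rfl⟩
    · refine Submodule.span_le.2 ?_
        (Li_mem_span_of_not_isReduced h ((length_le_weight a).trans hw.le) hw.le)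
      rintro _ ⟨b, hb, rfl⟩
      exact ih _ (hr ▸ hb.rank_lt) b (hb.weight_eq.trans hw) rfl

end ACMPL

end

theorem mainTheorem8 (F : Type*) [Field F] [Fintype F] [DecidableEq (RatFunc F)] (w : ℕ) :
    Submodule.span (RatFunc F) (ACMPL.AT F w) = ACMPL.AL F w := by
  refine le_antisymm (Submodule.span_mono ?_) (Submodule.span_le.2 ?_)
  · rintro _ ⟨a, hw, -, -, rfl⟩
    exact ⟨a, hw, rfl⟩
  · rintro _ ⟨a, rfl, rfl⟩
    exact ACMPL.Li_mem_span_AT a
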